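/- Let $B=(B_t)_{t\in\mathbb R}$ be a standard two-sided Brownian motion on a probability space $(\Omega,\mathcal F,P)$, that is, $(B_t)_{t\ge0}$ and $(B_{-t})_{t\ge0}$ are independent standard Brownian motions. For $g\in L^2(\mathbb R)$ let $\mathcal Fg$ denote its $L^2$-Fourier transform, normalized so that $(\mathcal Fg)(\lambda)=\int_{-\infty}^\infty g(t)e^{-\sqrt{-1}\lambda t}\,dt$, and put $g_j(t)=2^{j/2}g(2^jt)$ for $j=0,1,2,\dots$. Let $\tilde\phi,\tilde\psi\in L^2(\mathbb R)$ be real-valued functions such that $$|(\mathcal F\tilde\phi)(\lambda)|^2+\sum_{j=0}^\infty2^j|(\mathcal F\tilde\psi_j)(\lambda)|^2=1\qquad\text{for almost every }\lambda\in\mathbb R.$$ Then each of the processes $$\tilde\xi(u)=\int_{-\infty}^\infty\tilde\phi(s-u)\,dB_s,\qquad \tilde\xi_j(u)=\int_{-\infty}^\infty\tilde\psi_j(s-u)\,dB_s\qquad(u\in\mathbb R,\ j\ge0),$$ defined by Wiener integrals, has a jointly measurable version, and for any choice of such versions and every $t\in\mathbb R$ the following holds. For every $A>0$ the pathwise integrals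 $$\int_0^t\Big\{\int_{-A}^A\tilde\xi(u)\tilde\phi(s-u)\,du\Big\}ds,\qquad \int_0^t\Big\{\int_{-A}^A\tilde\xi_j(u)\tilde\psi_j(s-u)\,du\Big\}ds$$ exist almost surely and are square integrable; the limits $$\int_0^t\tilde\xi*\tilde\phi(s)\,ds:=\lim_{A\to\infty}\int_0^t\Big\{\int_{-A}^A\tilde\xi(u)\tilde\phi(s-u)\,du\Big\}ds,\qquad \int_0^t\tilde\xi_j*\tilde\psi_j(s)\,ds:=\lim_{A\to\infty}\int_0^t\Big\{\int_{-A}^A\tilde\xi_j(u)\tilde\psi_j(s-u)\,du\Big\}ds$$ exist in $L^2(P)$; and $$B_t=\int_0^t\tilde\xi*\tilde\phi(s)\,ds+\sum_{j=0}^\infty2^j\int_0^t\tilde\xi_j*\tilde\psi_j(s)\,ds,$$ where the series converges in $L^2(P)$. -/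

import Mathlib

open MeasureTheory ProbabilityTheory Filter Topology Set
open scoped NNReal ENNReal FourierTransform

/-- A (standard) two-sided Brownian motion indexed by `ℝ`: the processes `(B t)` and `(B (-t))`,
`t ≥ 0`, are independent standard Brownian motions (started at `0`, with almost surely continuous
paths). -/
structure IsTwoSidedBrownian {Ω : Type*} [MeasurableSpace Ω] (B : ℝ → Ω → ℝ) (P : Measure Ω) :
    Prop where
  right : IsBrownianReal (fun (t : ℝ≥0) ω => B t ω) P
  left : IsBrownianReal (fun (t : ℝ≥0) ω => B (-t) ω) P
  indep : IndepFun (fun ω (t : ℝ≥0) => B t ω) (fun ω (t : ℝ≥0) => B (-t) ω) P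

/-- Data of a real step function `∑ i, c i • 1_{(a i, b i]}` on the line. -/
structure StepData where
  /-- number of intervals -/
  n : ℕ
  /-- left end points -/
  a : Fin n → ℝ
  /-- right end points -/
  b : Fin n → ℝ
  /-- heights -/
  c : Fin n → ℝ
  le : ∀ i, a i ≤ b i

/-- The step function `∑ i, c i • 1_{(a i, b i]}`. -/
noncomputable def StepData.toFun (S : StepData) (x : ℝ) : ℝ :=
  ∑ i, S.c i * (Ioc (S.a i) (S.b i)).indicator (fun _ => (1 : ℝ)) x

/-- The elementary stochastic integral `∑ i, c i (B (b i) - B (a i))` of a step function. -/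
noncomputable def StepData.integral {Ω : Type*} (S : StepData) (B : ℝ → Ω → ℝ) (ω : Ω) : ℝ :=
  ∑ i, S.c i * (B (S.b i) ω - B (S.a i) ω)

/-- The random variable `X` is (a version of) the Wiener integral `∫ f(s) dB_s` over the line of
the deterministic function `f ∈ L²(ℝ)`: it is the `L²(P)`-limit of the elementary integrals of a
sequence of step functions that converges to `f` in `L²(ℝ)`. -/
def IsWienerIntegral {Ω : Type*} [MeasurableSpace Ω] (B : ℝ → Ω → ℝ) (P : Measure Ω)
    (f : ℝ → ℝ) (X : Ω → ℝ) : Prop :=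
  MemLp f 2 volume ∧ MemLp X 2 P ∧
    ∃ S : ℕ → StepData,
      Tendsto (fun n => eLpNorm (fun x => (S n).toFun x - f x) 2 volume) atTop (𝓝 0) ∧
      Tendsto (fun n => eLpNorm (fun ω => (S n).integral B ω - X ω) 2 P) atTop (𝓝 0)

/-- `ξ` is a jointly measurable version of the process `u ↦ ∫ g(s - u) dB_s`. -/
structure IsWaveletTransform {Ω : Type*} [MeasurableSpace Ω] (B : ℝ → Ω → ℝ) (P : Measure Ω)
    (g : ℝ → ℝ) (ξ : ℝ → Ω → ℝ) : Prop where
  measurable : Measurable (fun p : ℝ × Ω => ξ p.1 p.2)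
  wiener : ∀ u : ℝ, IsWienerIntegral B P (fun s => g (s - u)) (ξ u)

/-- The truncated convolution integral
`∫_0^t {∫_{-A}^A ξ(u) g(s - u) du} ds`, taken path by path. -/
noncomputable def truncConvIntegral {Ω : Type*} (g : ℝ → ℝ) (ξ : ℝ → Ω → ℝ) (t A : ℝ) (ω : Ω) :
    ℝ :=
  ∫ s in (0 : ℝ)..t, ∫ u in (-A)..A, ξ u ω * g (s - u)

/-- `Y` is (a version of) `∫_0^t (ξ * g)(s) ds`: the truncated convolution integrals exist almost
surely, are square integrable, and converge to `Y` in `L²(P)` as the truncation level `A` tends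
to infinity. -/
structure IsConvIntegral {Ω : Type*} [MeasurableSpace Ω] (P : Measure Ω) (g : ℝ → ℝ)
    (ξ : ℝ → Ω → ℝ) (t : ℝ) (Y : Ω → ℝ) : Prop where
  inner_integrable : ∀ᵐ ω ∂P, ∀ A > 0, ∀ s : ℝ,
    IntervalIntegrable (fun u => ξ u ω * g (s - u)) volume (-A) A
  outer_integrable : ∀ᵐ ω ∂P, ∀ A > 0,
    IntervalIntegrable (fun s => ∫ u in (-A)..A, ξ u ω * g (s - u)) volume 0 t
  memLp_trunc : ∀ A > 0, MemLp (truncConvIntegral g ξ t A) 2 P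
  memLp : MemLp Y 2 P
  tendsto : Tendsto (fun A : ℝ => eLpNorm (fun ω => truncConvIntegral g ξ t A ω - Y ω) 2 P)
    atTop (𝓝 0)

/-- The dilation `g_j(t) = 2^{j/2} g(2^j t)`. -/
noncomputable def dyadicDilate (j : ℕ) (g : ℝ → ℝ) (t : ℝ) : ℝ :=
  (2 : ℝ) ^ ((j : ℝ) / 2) * g ((2 : ℝ) ^ j * t)

theorem memLp_dyadicDilate {g : ℝ → ℝ} (hg : MemLp g 2 volume) (j : ℕ) :
    MemLp (dyadicDilate j g) 2 volume := by
  have h0 : (2 : ℝ) ^ j ≠ 0 := by positivity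
  have h1 : MemLp (fun t : ℝ => g ((2 : ℝ) ^ j * t)) 2 volume := by
    have h2 : MemLp g 2 (Measure.map (fun t : ℝ => (2 : ℝ) ^ j * t) volume) := by
      rw [Real.map_volume_mul_left h0]
      exact hg.smul_measure ENNReal.ofReal_ne_top
    exact (memLp_map_measure_iff h2.1 (by fun_prop)).1 h2
  exact h1.const_mul _

/-- The `L²`-Fourier transform, in the normalization `(F g)(l) = ∫ g(t) e^{-i l t} dt`, of a
real function `g ∈ L²(ℝ)`. (Mathlib's transform `𝓕` on `L²` has the kernel `e^{-2 π i l t}`.) It is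
determined up to a null set. -/
noncomputable def fourierL2 (g : ℝ → ℝ) (hg : MemLp g 2 (volume : Measure ℝ)) (l : ℝ) : ℂ :=
  (𝓕 (MemLp.toLp (fun t => (g t : ℂ)) hg.ofReal : Lp ℂ 2 (volume : Measure ℝ)) :
    Lp ℂ 2 (volume : Measure ℝ)) (l / (2 * Real.pi))

/-! The Wiener integral is an isometry `W : L²(ℝ) → L²(P)` sending the signed indicator `1_t` of
`(0, t]` (`stepLp t`) to `B_t`. With `T_u g = g(· - u)`, the process is `ξ(u) = W(T_u g)`. Fubini on
almost every path gives ∫_0^t ∫_{-A}^A ξ(u) g(s - u) du ds = W(∫_{-A}^A ⟨1_t, T_u g⟩ T_u g du), so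
the problem becomes deterministic (`truncConvIntegral_ae_eq`).

Let `C` be the Fourier multiplier with symbol `𝓕 g`; the Littlewood–Paley identity bounds this
symbol by `1`. For integrable `k ∈ L²`, `∫ k(u) T_u g du` is the convolution `C k`. By duality `u ↦
⟨e, T_u g⟩` is `C* e` (`inner_translateLp_ae_eq`). Hence the truncated integrals converge to `C C*
1_t` (`tendsto_integral_inner_smul_translateLp`).

The symbol of `C C*` is `|𝓕 g|²`. The weighted symbols sum to `1`, so by dominated convergence in
frequency the weighted sum of the operators `C C*` converges strongly to the identity
(`tendsto_convOp_adjoint_sum`). Evaluating at `1_t` and applying `W` gives `B_t`. -/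

/-! ### Isometries determined by Gram matrices. -/

section Hilbert

variable {ι H K : Type*} [NormedAddCommGroup H] [InnerProductSpace ℝ H]
  [NormedAddCommGroup K] [InnerProductSpace ℝ K]

theorem norm_linearCombination_eq_of_inner_eq {e : ι → H} {f : ι → K}
    (h : ∀ i j, inner ℝ (f i) (f j) = inner ℝ (e i) (e j)) (x : ι →₀ ℝ) :
    ‖Finsupp.linearCombination ℝ f x‖ = ‖Finsupp.linearCombination ℝ e x‖ := by
  have key : inner ℝ (Finsupp.linearCombination ℝ f x) (Finsupp.linearCombination ℝ f x) =
      inner ℝ (Finsupp.linearCombination ℝ e x) (Finsupp.linearCombination ℝ e x) := by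
    simp only [Finsupp.linearCombination_apply, Finsupp.sum, sum_inner, inner_sum, inner_smul_left,
      inner_smul_right, h]
  rw [real_inner_self_eq_norm_sq, real_inner_self_eq_norm_sq] at key
  exact (pow_left_inj₀ (norm_nonneg _) (norm_nonneg _) two_ne_zero).1 key

/-- Equal Gram matrices make the correspondence `e i ↦ f i` well defined and isometric on linear
combinations; density and completeness extend it. This will produce `W`. -/
theorem exists_continuousLinearMap_of_inner_eq [CompleteSpace K] {e : ι → H} {f : ι → K}
    (h : ∀ i j, inner ℝ (f i) (f j) = inner ℝ (e i) (e j))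
    (hd : DenseRange (Finsupp.linearCombination ℝ e)) :
    ∃ W : H →L[ℝ] K, ∀ i, W (e i) = f i := by
  refine ⟨(Finsupp.linearCombination ℝ f).extendOfNorm (Finsupp.linearCombination ℝ e),
    fun i => ?_⟩
  have := LinearMap.extendOfNorm_eq (f := Finsupp.linearCombination ℝ f) hd
    ⟨1, fun x => by rw [one_mul, norm_linearCombination_eq_of_inner_eq h]⟩ (Finsupp.single i 1)
  simpa using this

end Hilbert

/-! ### Dominated convergence and vector-valued integrals in L². -/

section LpLemmas

variable {α E : Type*} [MeasurableSpace α] {μ : Measure α} [NormedAddCommGroup E]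

/-- Dominated convergence to zero in `L²`. -/
theorem tendsto_eLpNorm_two_zero_of_dominated {ι : Type*} {l : Filter ι} [l.IsCountablyGenerated]
    {G : ι → α → E} {bound : α → ℝ} (hG : ∀ n, AEStronglyMeasurable (G n) μ)
    (hb : MemLp bound 2 μ) (hle : ∀ n, ∀ᵐ a ∂μ, ‖G n a‖ ≤ bound a)
    (hlim : ∀ᵐ a ∂μ, Tendsto (fun n => G n a) l (𝓝 0)) :
    Tendsto (fun n => eLpNorm (G n) 2 μ) l (𝓝 0) := by
  -- Countable generation of `l` reduces the claim to sequences, as dominated convergence requires.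
  refine tendsto_of_seq_tendsto fun v hv => ?_
  have key : Tendsto (fun n => ∫⁻ a, ‖G (v n) a‖ₑ ^ (2 : ℝ) ∂μ) atTop (𝓝 (∫⁻ _, 0 ∂μ)) := by
    refine tendsto_lintegral_of_dominated_convergence' (fun a => ‖bound a‖ₑ ^ (2 : ℝ))
      (fun n => (hG _).enorm.pow_const _) (fun n => ?_) ?_ ?_
    · filter_upwards [hle (v n)] with a ha
      gcongr
      rw [← ofReal_norm, ← ofReal_norm]
      exact ENNReal.ofReal_le_ofReal (ha.trans (le_abs_self _))
    · have := lintegral_rpow_enorm_lt_top_of_eLpNorm_lt_top (p := 2) (by simp) (by simp) hb.2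
      simpa using this.ne
    · filter_upwards [hlim] with a ha
      have h1 : Tendsto (fun n => ‖G (v n) a‖ₑ) atTop (𝓝 0) := by
        simpa using (ha.comp hv).enorm
      simpa [Function.comp_def] using
        (ENNReal.continuous_rpow_const (y := 2)).tendsto 0 |>.comp h1
  simp only [lintegral_zero] at key
  have h2 := (ENNReal.continuous_rpow_const (y := 1 / 2)).tendsto 0 |>.comp key
  simp only [eLpNorm_eq_lintegral_rpow_enorm_toReal (p := 2) (by simp) (by simp)]
  simpa [Function.comp_def] using h2

/-- Cauchy–Schwarz against an indicator. The bound depends on `f` only through its norm, which gives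
uniformity over translates in the Fubini arguments. -/
theorem setIntegral_norm_le_norm_Lp_two {s : Set α} (hs : MeasurableSet s) (hμs : μ s ≠ ∞)
    (f : Lp E 2 μ) :
    ∫ x in s, ‖f x‖ ∂μ ≤ ‖indicatorConstLp 2 hs hμs (1 : ℝ)‖ * ‖f‖ := by
  let N : Lp ℝ 2 μ := MemLp.toLp (fun x => ‖f x‖) (Lp.memLp f).norm
  have h2 : ∫ x in s, N x ∂μ = ∫ x in s, ‖f x‖ ∂μ :=
    integral_congr_ae (ae_restrict_of_ae (Lp.memLp f).norm.coeFn_toLp)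
  have h3 : ‖N‖ = ‖f‖ := by
    rw [Lp.norm_toLp, eLpNorm_norm, Lp.norm_def]
  rw [← h2, ← h3, ← L2.inner_indicatorConstLp_one hs hμs N]
  exact real_inner_le_norm _ _

variable {β 𝕜 : Type*} [MeasurableSpace β] [RCLike 𝕜] {ν : Measure β}

/-- A Bochner integral with values in `L²` can be computed pointwise. -/
theorem coeFn_integral_Lp_two [SFinite ν] [SigmaFinite μ] {X : β → Lp 𝕜 2 μ}
    (hX : Integrable X ν) {ξ : β → α → 𝕜}
    (hξ : AEStronglyMeasurable (fun p : β × α => ξ p.1 p.2) (ν.prod μ))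
    (h : ∀ᵐ u ∂ν, X u =ᵐ[μ] ξ u) :
    (∫ u, X u ∂ν : Lp 𝕜 2 μ) =ᵐ[μ] fun x => ∫ u, ξ u x ∂ν := by
  have hint : ∀ s, MeasurableSet s → μ s < ∞ →
      Integrable (fun p : β × α => ξ p.1 p.2) (ν.prod (μ.restrict s)) := by
    intro s hs hμs
    have : IsFiniteMeasure (μ.restrict s) := ⟨by simpa using hμs⟩
    have hξ' : AEStronglyMeasurable (fun p : β × α => ξ p.1 p.2) (ν.prod (μ.restrict s)) := by
      refine hξ.mono_ac ?_
      exact Measure.AbsolutelyContinuous.rfl.prod Measure.restrict_le_self.absolutelyContinuous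
    rw [integrable_prod_iff hξ']
    have h1 : ∀ u, IntegrableOn (X u) s μ := fun u =>
      integrableOn_Lp_of_measure_ne_top _ one_le_two hμs.ne
    constructor
    · filter_upwards [h] with u hu
      exact (h1 u).congr (ae_restrict_of_ae hu)
    · refine Integrable.mono' (hX.norm.const_mul ‖indicatorConstLp 2 hs hμs.ne (1 : ℝ)‖)
        hξ'.norm.integral_prod_right' ?_
      filter_upwards [h] with u hu
      rw [Real.norm_of_nonneg (integral_nonneg fun _ => norm_nonneg _)]
      have h2 : ∫ y in s, ‖ξ u y‖ ∂μ = ∫ y in s, ‖X u y‖ ∂μ :=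
        integral_congr_ae (ae_restrict_of_ae (hu.mono fun y hy => by simp only [hy]))
      rw [h2]
      exact setIntegral_norm_le_norm_Lp_two hs hμs.ne _
  -- Integrating over a set of finite measure is pairing with its indicator, which commutes with the
  -- Bochner integral; on the pointwise side Fubini does the same.
  refine ae_eq_of_forall_setIntegral_eq_of_sigmaFinite
    (fun s hs hμs => integrableOn_Lp_of_measure_ne_top _ one_le_two hμs.ne)
    (fun s hs hμs => (hint s hs hμs).integral_prod_right) fun s hs hμs => ?_
  rw [← integral_integral_swap (hint s hs hμs), ← L2.inner_indicatorConstLp_one hs hμs.ne,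
    ← integral_inner hX]
  refine integral_congr_ae ?_
  filter_upwards [h] with u hu
  rw [L2.inner_indicatorConstLp_one hs hμs.ne]
  exact integral_congr_ae (ae_restrict_of_ae hu)

end LpLemmas

/-! ### Multiplication operators and their adjoints. -/

section Multiplier

variable {α : Type*} [MeasurableSpace α] {μ : Measure α}

/-- Multiplication by a bounded function, as an operator on `L²`. -/
noncomputable def mulLpTwo (m : Lp ℂ ∞ μ) : Lp ℂ 2 μ →L[ℂ] Lp ℂ 2 μ :=
  (ContinuousLinearMap.mul ℂ ℂ).holderL μ ∞ 2 2 m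

theorem coeFn_mulLpTwo (m : Lp ℂ ∞ μ) (f : Lp ℂ 2 μ) :
    mulLpTwo m f =ᵐ[μ] fun x => m x * f x :=
  ContinuousLinearMap.coeFn_holder (r := 2) (ContinuousLinearMap.mul ℂ ℂ) m f

theorem coeFn_adjoint_mulLpTwo (m : Lp ℂ ∞ μ) (f : Lp ℂ 2 μ) :
    ContinuousLinearMap.adjoint (mulLpTwo m) f =ᵐ[μ] fun x => star (m x) * f x := by
  have : ContinuousLinearMap.adjoint (mulLpTwo m) = mulLpTwo (star m) := by
    symm
    rw [ContinuousLinearMap.eq_adjoint_iff]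
    intro f g
    rw [L2.inner_def, L2.inner_def]
    refine integral_congr_ae ?_
    filter_upwards [coeFn_mulLpTwo m g, coeFn_mulLpTwo (star m) f, Lp.coeFn_star m]
      with x h1 h2 h3
    rw [h1, h2, h3]
    simp
    ring
  rw [this]
  filter_upwards [coeFn_mulLpTwo (star m) f, Lp.coeFn_star m] with x h2 h3
  rw [h2, h3]
  rfl

theorem coeFn_mulLpTwo_adjoint_mulLpTwo (m : Lp ℂ ∞ μ) (f : Lp ℂ 2 μ) :
    mulLpTwo m (ContinuousLinearMap.adjoint (mulLpTwo m) f) =ᵐ[μ]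
      fun x => ((‖m x‖ ^ 2 : ℝ) : ℂ) * f x := by
  filter_upwards [coeFn_mulLpTwo m (ContinuousLinearMap.adjoint (mulLpTwo m) f),
    coeFn_adjoint_mulLpTwo m f] with x h1 h2
  rw [h1, h2, ← mul_assoc]
  congr 1
  simpa using Complex.mul_conj' (m x)

end Multiplier

/-! ### Translations on L²(ℝ). -/

section Translation

variable {E : Type*} [NormedAddCommGroup E]

/-- The translation `f ↦ f (· - u)` on `L²(ℝ)`. -/
noncomputable def translateLp (u : ℝ) :
    Lp E 2 (volume : Measure ℝ) →+ Lp E 2 (volume : Measure ℝ) :=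
  Lp.compMeasurePreserving (fun s => s - u) (measurePreserving_sub_right volume u)

theorem coeFn_translateLp (u : ℝ) (f : Lp E 2 (volume : Measure ℝ)) :
    translateLp u f =ᵐ[volume] fun s => f (s - u) :=
  Lp.coeFn_compMeasurePreserving f _

@[simp]
theorem norm_translateLp (u : ℝ) (f : Lp E 2 (volume : Measure ℝ)) : ‖translateLp u f‖ = ‖f‖ :=
  Lp.norm_compMeasurePreserving f _

theorem continuous_translateLp_left (u : ℝ) :
    Continuous (translateLp u : Lp E 2 (volume : Measure ℝ) → _) :=
  (Lp.isometry_compMeasurePreserving _).continuous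

theorem continuous_translateLp (f : Lp E 2 (volume : Measure ℝ)) :
    Continuous fun u => translateLp u f := by
  have h : Continuous fun u : ℝ => (⟨fun s => s - u, by fun_prop⟩ : C(ℝ, ℝ)) :=
    ContinuousMap.continuous_of_continuous_uncurry _ (by
      simp only [Function.uncurry_def, ContinuousMap.coe_mk]; fun_prop)
  exact Continuous.compMeasurePreservingLp (f := fun _ : ℝ => f) continuous_const h
    (fun u => measurePreserving_sub_right volume u) (by simp)

theorem translateLp_translateLp (u v : ℝ) (f : Lp E 2 (volume : Measure ℝ)) :
    translateLp u (translateLp v f) = translateLp (u + v) f := by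
  refine Lp.ext ?_
  have h := (measurePreserving_sub_right volume u).quasiMeasurePreserving.ae
    (coeFn_translateLp v f)
  filter_upwards [coeFn_translateLp u (translateLp v f), coeFn_translateLp (u + v) f, h]
    with x h1 h2 h3
  rw [h1, h2, h3]
  congr 1
  ring

theorem memLp_comp_sub_right {g : ℝ → E} (hg : MemLp g 2 volume) (u : ℝ) :
    MemLp (fun s => g (s - u)) 2 volume :=
  hg.comp_measurePreserving (measurePreserving_sub_right volume u)

end Translation

/-! ### Fourier transform of translates and convolutions. -/

section Fourier

/-- The character `x ↦ exp (-2 π i u x)` as a bounded function. -/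
noncomputable def charLp (u : ℝ) : Lp ℂ ∞ (volume : Measure ℝ) :=
  MemLp.toLp (fun x => (Real.fourierChar (-(u * x)) : ℂ))
    (memLp_top_of_bound (C := 1) (by fun_prop)
      (.of_forall fun x => (Circle.norm_coe _).le))

theorem coeFn_charLp (u : ℝ) :
    charLp u =ᵐ[volume] fun x => (Real.fourierChar (-(u * x)) : ℂ) :=
  MemLp.coeFn_toLp _

/-- Both sides are continuous in `f`, so it suffices to check Schwartz functions, where the
transform is an honest integral. -/
theorem fourier_translateLp (u : ℝ) (f : Lp ℂ 2 (volume : Measure ℝ)) :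
    𝓕 (translateLp u f) = mulLpTwo (charLp u) (𝓕 f) := by
  refine DenseRange.induction_on (p := fun f : Lp ℂ 2 (volume : Measure ℝ) =>
      𝓕 (translateLp u f) = mulLpTwo (charLp u) (𝓕 f))
    (SchwartzMap.denseRange_toLpCLM (p := 2) ENNReal.ofNat_ne_top) f ?_ fun f => ?_
  · exact isClosed_eq
      ((Lp.fourierTransformₗᵢ ℝ ℂ).continuous.comp (continuous_translateLp_left u))
      ((mulLpTwo (charLp u)).continuous.comp (Lp.fourierTransformₗᵢ ℝ ℂ).continuous)
  · have h1 : translateLp u (f.toLp 2) = (f.compSubConstCLM ℂ u).toLp 2 := rfl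
    change 𝓕 (translateLp u (f.toLp 2)) = mulLpTwo (charLp u) (𝓕 (f.toLp 2))
    rw [h1, SchwartzMap.toLp_fourier_eq, SchwartzMap.toLp_fourier_eq]
    refine Lp.ext ?_
    filter_upwards [coeFn_mulLpTwo (charLp u) ((𝓕 f).toLp 2), coeFn_charLp u,
      (𝓕 f).coeFn_toLp 2 volume, (𝓕 (f.compSubConstCLM ℂ u)).coeFn_toLp 2 volume]
      with x h2 h3 h4 h5
    rw [h2, h3, h4, h5, SchwartzMap.fourier_coe, SchwartzMap.fourier_coe]
    have h6 := congrFun (VectorFourier.fourierIntegral_comp_add_right Real.fourierChar volume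
      (innerₗ ℝ) f (-u)) x
    simp only [innerₗ_apply_apply, Circle.smul_def, smul_eq_mul] at h6
    rw [show -(u * x) = inner ℝ (-u) x by simp [mul_comm]]
    exact h6

/-- Tested against a smooth compactly supported function, either transform can be moved onto the
test function: one by the distributional definition, the other by Fubini. -/
theorem coeFn_fourier_of_integrable (k : Lp ℂ 2 (volume : Measure ℝ)) (hk : Integrable k) :
    (𝓕 k : Lp ℂ 2 (volume : Measure ℝ)) =ᵐ[volume] 𝓕 (k : ℝ → ℂ) := by
  have hcont : Continuous (𝓕 (k : ℝ → ℂ)) :=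
    VectorFourier.fourierIntegral_continuous Real.continuous_fourierChar
      (by exact continuous_inner) hk
  refine ae_eq_of_integral_contDiff_smul_eq ((Lp.memLp _).locallyIntegrable one_le_two)
    hcont.locallyIntegrable fun g g_smooth g_cpt => ?_
  have hg₁ : HasCompactSupport (Complex.ofRealCLM ∘ g) := g_cpt.comp_left rfl
  have hg₂ : ContDiff ℝ ((⊤ : ℕ∞) : WithTop ℕ∞) (Complex.ofRealCLM ∘ g) :=
    Complex.ofRealCLM.contDiff.comp g_smooth
  set G : SchwartzMap ℝ ℂ := hg₁.toSchwartzMap hg₂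
  have hG : ∀ x, G x = g x := fun x => rfl
  have h1 := DFunLike.congr_fun (Lp.fourier_toTemperedDistribution_eq k) G
  rw [TemperedDistribution.fourier_apply, Lp.toTemperedDistribution_apply,
    Lp.toTemperedDistribution_apply] at h1
  have h2 := VectorFourier.integral_fourierIntegral_smul_eq_flip (μ := volume) (ν := volume)
    (L := innerₗ ℝ) (f := G) (g := k) Real.continuous_fourierChar
    (by exact continuous_inner) G.integrable hk
  rw [flip_innerₗ] at h2
  calc ∫ x, g x • (𝓕 k : Lp ℂ 2 (volume : Measure ℝ)) x
      = ∫ x, G x • (𝓕 k : Lp ℂ 2 (volume : Measure ℝ)) x := by simp [hG]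
    _ = ∫ x, (𝓕 G) x • k x := h1.symm
    _ = ∫ x, G x • 𝓕 (k : ℝ → ℂ) x := h2
    _ = ∫ x, g x • 𝓕 (k : ℝ → ℂ) x := by simp [hG]

/-- The convolution theorem, for the convolution as a Bochner integral of translates. -/
theorem fourier_integral_smul_translateLp {f : Lp ℂ 2 (volume : Measure ℝ)}
    {m : Lp ℂ ∞ (volume : Measure ℝ)}
    (hm : m =ᵐ[volume] (𝓕 f : Lp ℂ 2 (volume : Measure ℝ)))
    (k : Lp ℂ 2 (volume : Measure ℝ)) (hk : Integrable k) :
    𝓕 (∫ u, k u • translateLp u f) = mulLpTwo m (𝓕 k) := by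
  have hint : Integrable fun u => k u • translateLp u f :=
    hk.smul_bdd ‖f‖ (continuous_translateLp f).aestronglyMeasurable
      (.of_forall fun u => (norm_translateLp u f).le)
  have h1 : 𝓕 (∫ u, k u • translateLp u f) = ∫ u, k u • mulLpTwo (charLp u) (𝓕 f) := by
    have := (Lp.fourierTransformₗᵢ ℝ ℂ).toContinuousLinearEquiv.integral_comp_comm
      (fun u => k u • translateLp u f) (μ := volume)
    refine this.symm.trans (integral_congr_ae (.of_forall fun u => ?_))
    change (Lp.fourierTransformₗᵢ ℝ ℂ) (k u • translateLp u f) =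
      k u • mulLpTwo (charLp u) (𝓕 f)
    rw [map_smul, ← fourier_translateLp]
    rfl
  have hint' : Integrable fun u => k u • mulLpTwo (charLp u) (𝓕 f) := by
    have := (Lp.fourierTransformₗᵢ ℝ ℂ).toContinuousLinearEquiv.integrable_comp_iff.2 hint
    refine this.congr (.of_forall fun u => ?_)
    change (Lp.fourierTransformₗᵢ ℝ ℂ) (k u • translateLp u f) =
      k u • mulLpTwo (charLp u) (𝓕 f)
    rw [map_smul, ← fourier_translateLp]
    rfl
  rw [h1]
  refine Lp.ext ?_
  -- Evaluated at frequency `x`, the vector-valued integral is a scalar one, from which `(𝓕 f) x`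
  -- factors out and leaves the Fourier integral of `k`.
  have h2 := coeFn_integral_Lp_two (μ := (volume : Measure ℝ)) hint'
    (ξ := fun u x => k u * (Real.fourierChar (-(u * x)) *
      (𝓕 f : Lp ℂ 2 (volume : Measure ℝ)) x)) (by
        refine (Lp.aestronglyMeasurable k).comp_fst.mul (AEStronglyMeasurable.mul ?_
          (Lp.aestronglyMeasurable _).comp_snd)
        exact Continuous.aestronglyMeasurable (by fun_prop))
    (.of_forall fun u => by
      filter_upwards [Lp.coeFn_smul (k u) (mulLpTwo (charLp u) (𝓕 f)),
        coeFn_mulLpTwo (charLp u) (𝓕 f), coeFn_charLp u] with x h3 h4 h5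
      rw [h3, Pi.smul_apply, h4, h5, smul_eq_mul])
  filter_upwards [h2, coeFn_mulLpTwo m (𝓕 k), hm, coeFn_fourier_of_integrable k hk]
    with x h3 h4 h5 h6
  rw [h3, h4, h5, h6, Real.fourier_eq, ← integral_const_mul]
  refine integral_congr_ae (.of_forall fun u => ?_)
  simp only [Circle.smul_def, smul_eq_mul, RCLike.inner_apply, conj_trivial, mul_comm x u]
  ring

end Fourier

/-! ### Passage between real and complex L². -/

section Complexification

/-- The inclusion of real into complex `L²`. -/
noncomputable def ofRealLp :
    Lp ℝ 2 (volume : Measure ℝ) →L[ℝ] Lp ℂ 2 (volume : Measure ℝ) :=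
  Complex.ofRealCLM.compLpL 2 volume

/-- The real part, as a map from complex to real `L²`. -/
noncomputable def reLp :
    Lp ℂ 2 (volume : Measure ℝ) →L[ℝ] Lp ℝ 2 (volume : Measure ℝ) :=
  Complex.reCLM.compLpL 2 volume

theorem coeFn_ofRealLp (f : Lp ℝ 2 (volume : Measure ℝ)) :
    ofRealLp f =ᵐ[volume] fun x => (f x : ℂ) :=
  Complex.ofRealCLM.coeFn_compLpL f

theorem coeFn_reLp (f : Lp ℂ 2 (volume : Measure ℝ)) :
    reLp f =ᵐ[volume] fun x => (f x).re :=
  Complex.reCLM.coeFn_compLpL f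

@[simp]
theorem reLp_ofRealLp (f : Lp ℝ 2 (volume : Measure ℝ)) : reLp (ofRealLp f) = f := by
  refine Lp.ext ?_
  filter_upwards [coeFn_reLp (ofRealLp f), coeFn_ofRealLp f] with x h1 h2
  rw [h1, h2, Complex.ofReal_re]

theorem ofRealLp_translateLp (u : ℝ) (f : Lp ℝ 2 (volume : Measure ℝ)) :
    ofRealLp (translateLp u f) = translateLp u (ofRealLp f) := by
  refine Lp.ext ?_
  have h := (measurePreserving_sub_right volume u).quasiMeasurePreserving.ae (coeFn_ofRealLp f)
  filter_upwards [coeFn_ofRealLp (translateLp u f), coeFn_translateLp u f,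
    coeFn_translateLp u (ofRealLp f), h] with x h1 h2 h3 h4
  rw [h1, h2, h3, h4]

theorem inner_ofRealLp (f g : Lp ℝ 2 (volume : Measure ℝ)) :
    inner ℂ (ofRealLp f) (ofRealLp g) = ((inner ℝ f g : ℝ) : ℂ) := by
  rw [L2.inner_def, L2.inner_def, ← integral_complex_ofReal]
  refine integral_congr_ae ?_
  filter_upwards [coeFn_ofRealLp f, coeFn_ofRealLp g] with x h1 h2
  simp [h1, h2]

theorem ofRealLp_toLp {g : ℝ → ℝ} (hg : MemLp g 2 volume) :
    ofRealLp hg.toLp = MemLp.toLp (fun t => (g t : ℂ)) hg.ofReal := by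
  refine Lp.ext ?_
  filter_upwards [coeFn_ofRealLp hg.toLp, hg.coeFn_toLp, MemLp.coeFn_toLp (hg.ofReal (K := ℂ))]
    with x h1 h2 h3
  rw [h1, h2]
  exact h3.symm

end Complexification

/-! ### Convolution as a Fourier multiplier. -/

section ConvOp

/-- The Fourier multiplier operator with symbol `m` on `L²(ℝ)`. -/
noncomputable def convOp (m : Lp ℂ ∞ (volume : Measure ℝ)) :
    Lp ℂ 2 (volume : Measure ℝ) →L[ℂ] Lp ℂ 2 (volume : Measure ℝ) :=
  (Lp.fourierTransformₗᵢ ℝ ℂ).symm.toContinuousLinearEquiv.toContinuousLinearMap ∘L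
    mulLpTwo m ∘L (Lp.fourierTransformₗᵢ ℝ ℂ).toContinuousLinearEquiv.toContinuousLinearMap

theorem fourier_convOp (m : Lp ℂ ∞ (volume : Measure ℝ)) (f : Lp ℂ 2 (volume : Measure ℝ)) :
    𝓕 (convOp m f) = mulLpTwo m (𝓕 f) :=
  (Lp.fourierTransformₗᵢ ℝ ℂ).apply_symm_apply _

/-- By Plancherel, conjugation by the Fourier transform respects adjoints. -/
theorem fourier_adjoint_convOp (m : Lp ℂ ∞ (volume : Measure ℝ))
    (f : Lp ℂ 2 (volume : Measure ℝ)) :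
    𝓕 (ContinuousLinearMap.adjoint (convOp m) f) =
      ContinuousLinearMap.adjoint (mulLpTwo m) (𝓕 f) := by
  refine ext_inner_left ℂ fun g => ?_
  obtain ⟨g, rfl⟩ := (Lp.fourierTransformₗᵢ ℝ ℂ).surjective g
  change inner ℂ (𝓕 g) _ = inner ℂ (𝓕 g) _
  rw [Lp.inner_fourier_eq, ContinuousLinearMap.adjoint_inner_right,
    ContinuousLinearMap.adjoint_inner_right, ← fourier_convOp, Lp.inner_fourier_eq]

theorem coeFn_fourier_convOp_adjoint (m : Lp ℂ ∞ (volume : Measure ℝ))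
    (f : Lp ℂ 2 (volume : Measure ℝ)) :
    (𝓕 (convOp m (ContinuousLinearMap.adjoint (convOp m) f)) : Lp ℂ 2 (volume : Measure ℝ))
      =ᵐ[volume] fun x => ((‖m x‖ ^ 2 : ℝ) : ℂ) * (𝓕 f : Lp ℂ 2 (volume : Measure ℝ)) x := by
  rw [fourier_convOp, fourier_adjoint_convOp]
  exact coeFn_mulLpTwo_adjoint_mulLpTwo m (𝓕 f)

variable {f : Lp ℝ 2 (volume : Measure ℝ)} {m : Lp ℂ ∞ (volume : Measure ℝ)}

theorem integrable_smul_translateLp (f : Lp ℝ 2 (volume : Measure ℝ)) {k : ℝ → ℝ}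
    (hk : Integrable k) : Integrable fun u => k u • translateLp u f :=
  hk.smul_bdd ‖f‖ (continuous_translateLp f).aestronglyMeasurable
    (.of_forall fun u => (norm_translateLp u f).le)

theorem ofRealLp_integral_smul_translateLp
    (hm : m =ᵐ[volume] (𝓕 (ofRealLp f) : Lp ℂ 2 (volume : Measure ℝ)))
    (k : Lp ℝ 2 (volume : Measure ℝ)) (hk : Integrable k) :
    ofRealLp (∫ u, k u • translateLp u f) = convOp m (ofRealLp k) := by
  have hk' : Integrable (ofRealLp k) := hk.ofReal.congr (coeFn_ofRealLp k).symm
  have h := fourier_integral_smul_translateLp hm (ofRealLp k) hk'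
  rw [← fourier_convOp] at h
  rw [← (Lp.fourierTransformₗᵢ ℝ ℂ).injective h,
    ← ofRealLp.integral_comp_comm (integrable_smul_translateLp f hk)]
  refine integral_congr_ae ?_
  filter_upwards [coeFn_ofRealLp k] with u hu
  rw [map_smul, hu, ofRealLp_translateLp]
  exact (Complex.coe_smul _ _).symm

theorem continuous_inner_translateLp (e f : Lp ℝ 2 (volume : Measure ℝ)) :
    Continuous fun u => inner ℝ e (translateLp u f) :=
  continuous_const.inner (continuous_translateLp f)

/-- Against the indicator `k` of a set of finite measure, the left side integrates to `⟨e, ∫ k(u)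
T_u f du⟩ = ⟨e, C k⟩ = ⟨C* e, k⟩`. In particular the coefficients are square integrable in `u`. -/
theorem inner_translateLp_ae_eq (e : Lp ℝ 2 (volume : Measure ℝ))
    (hm : m =ᵐ[volume] (𝓕 (ofRealLp f) : Lp ℂ 2 (volume : Measure ℝ))) :
    (fun u => ((inner ℝ e (translateLp u f) : ℝ) : ℂ)) =ᵐ[volume]
      ContinuousLinearMap.adjoint (convOp m) (ofRealLp e) := by
  have hbdd : ∀ u, ‖inner ℝ e (translateLp u f)‖ ≤ ‖e‖ * ‖f‖ := fun u =>
    (norm_inner_le_norm _ _).trans_eq (by rw [norm_translateLp])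
  refine ae_eq_of_forall_setIntegral_eq_of_sigmaFinite (fun s hs hμs => ?_)
    (fun s hs hμs => integrableOn_Lp_of_measure_ne_top _ one_le_two hμs.ne) fun s hs hμs => ?_
  · refine IntegrableOn.of_bound hμs
      (Complex.continuous_ofReal.comp (continuous_inner_translateLp e f)).aestronglyMeasurable
      (‖e‖ * ‖f‖) (.of_forall fun u => ?_)
    rw [Complex.norm_real]
    exact hbdd u
  · let k : Lp ℝ 2 (volume : Measure ℝ) := indicatorConstLp 2 hs hμs.ne (1 : ℝ)
    have hk : k =ᵐ[volume] s.indicator fun _ => (1 : ℝ) := indicatorConstLp_coeFn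
    have hkint : Integrable k :=
      ((integrable_indicator_iff hs).2 (integrableOn_const hμs.ne)).congr hk.symm
    have hok : ofRealLp k = indicatorConstLp 2 hs hμs.ne (1 : ℂ) := by
      refine Lp.ext ?_
      filter_upwards [coeFn_ofRealLp k, hk,
        indicatorConstLp_coeFn (p := 2) (hs := hs) (hμs := hμs.ne) (c := (1 : ℂ))] with x h1 h2 h3
      rw [h1, h2, h3]
      by_cases hx : x ∈ s <;> simp [hx]
    have h1 : inner ℝ e (∫ u, k u • translateLp u f) =
        ∫ u in s, inner ℝ e (translateLp u f) := by
      rw [← integral_inner (integrable_smul_translateLp f hkint), ← integral_indicator hs]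
      refine integral_congr_ae ?_
      filter_upwards [hk] with u hu
      rw [hu, inner_smul_right]
      by_cases hx : u ∈ s <;> simp [hx]
    rw [integral_complex_ofReal, ← h1, ← L2.inner_indicatorConstLp_one hs hμs.ne, ← hok,
      ContinuousLinearMap.adjoint_inner_right, ← ofRealLp_integral_smul_translateLp hm k hkint,
      inner_ofRealLp, real_inner_comm]

/-- The coefficient function `h = C* e` need not be integrable, but its truncations are. The
convolution formula applies to them, they tend to `h` in L², and `C` is continuous. -/
theorem tendsto_integral_inner_smul_translateLp (e : Lp ℝ 2 (volume : Measure ℝ))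
    (hm : m =ᵐ[volume] (𝓕 (ofRealLp f) : Lp ℂ 2 (volume : Measure ℝ))) :
    Tendsto (fun A : ℝ => ∫ u in (-A)..A, inner ℝ e (translateLp u f) • translateLp u f) atTop
      (𝓝 (reLp (convOp m (ContinuousLinearMap.adjoint (convOp m) (ofRealLp e))))) := by
  set h : ℝ → ℝ := fun u => inner ℝ e (translateLp u f) with hdef
  have hcont : Continuous h := continuous_inner_translateLp e f
  set H := ContinuousLinearMap.adjoint (convOp m) (ofRealLp e)
  have hH : (fun u => (h u : ℂ)) =ᵐ[volume] H := inner_translateLp_ae_eq e hm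
  have hL : MemLp h 2 volume := by
    have := ((Lp.memLp H).re).ae_eq (hH.symm.mono fun u hu => by rw [hu])
    simpa using this
  have hLA : ∀ A : ℝ, MemLp ((Ioc (-A) A).indicator h) 2 volume :=
    fun A => hL.indicator measurableSet_Ioc
  have hIA : ∀ A : ℝ, Integrable ((Ioc (-A) A).indicator h) := fun A =>
    (integrable_indicator_iff measurableSet_Ioc).2
      (hcont.integrableOn_Ioc)
  have hlim : Tendsto (fun A => (hLA A).toLp) atTop (𝓝 hL.toLp) := by
    rw [Lp.tendsto_Lp_iff_tendsto_eLpNorm'']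
    refine tendsto_eLpNorm_two_zero_of_dominated (bound := fun u => ‖h u‖)
      (fun A => ((hLA A).sub hL).1) hL.norm (fun A => .of_forall fun u => ?_)
      (.of_forall fun u => ?_)
    · by_cases hu : u ∈ Ioc (-A) A <;> simp [hu]
    · refine tendsto_const_nhds.congr' ?_
      filter_upwards [eventually_gt_atTop |u|] with A hA
      have : u ∈ Ioc (-A) A := ⟨(abs_lt.1 hA).1, (abs_lt.1 hA).2.le⟩
      simp [this]
  have hoh : ofRealLp hL.toLp = H := by
    refine Lp.ext ?_
    filter_upwards [coeFn_ofRealLp hL.toLp, hL.coeFn_toLp, hH] with x h1 h2 h3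
    rw [h1, h2, h3]
  have key := (reLp.continuous.comp ((convOp m).continuous.comp
    ofRealLp.continuous)).tendsto hL.toLp |>.comp hlim
  simp only [Function.comp_apply, hoh] at key
  refine key.congr' ?_
  filter_upwards [eventually_ge_atTop 0] with A hA
  have hAint : Integrable (hLA A).toLp := (hIA A).congr (hLA A).coeFn_toLp.symm
  simp only [Function.comp_apply]
  rw [← ofRealLp_integral_smul_translateLp hm _ hAint, reLp_ofRealLp,
    intervalIntegral.integral_of_le (by linarith), ← integral_indicator measurableSet_Ioc]
  refine integral_congr_ae ?_
  filter_upwards [(hLA A).coeFn_toLp] with u hu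
  rw [hu]
  by_cases hx : u ∈ Ioc (-A) A <;> simp [hx, hdef]

end ConvOp

/-! ### Signed indicators and density of step functions. -/

section StepFunctions

/-- The signed indicator `1_{(0, t]} - 1_{(t, 0]}`, as an element of `L²(ℝ)`. -/
noncomputable def stepLp (t : ℝ) : Lp ℝ 2 (volume : Measure ℝ) :=
  indicatorConstLp 2 (s := Ioc 0 t) measurableSet_Ioc (by simp) (1 : ℝ) -
    indicatorConstLp 2 (s := Ioc t 0) measurableSet_Ioc (by simp) (1 : ℝ)

theorem coeFn_stepLp (t : ℝ) : stepLp t =ᵐ[volume] fun x =>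
    (Ioc 0 t).indicator (fun _ => (1 : ℝ)) x - (Ioc t 0).indicator (fun _ => (1 : ℝ)) x := by
  have h1 := indicatorConstLp_coeFn (p := 2) (μ := (volume : Measure ℝ)) (s := Ioc 0 t)
    (hs := measurableSet_Ioc) (hμs := by simp) (c := (1 : ℝ))
  have h2 := indicatorConstLp_coeFn (p := 2) (μ := (volume : Measure ℝ)) (s := Ioc t 0)
    (hs := measurableSet_Ioc) (hμs := by simp) (c := (1 : ℝ))
  filter_upwards [h1, h2, Lp.coeFn_sub (indicatorConstLp 2 (μ := (volume : Measure ℝ))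
    (s := Ioc 0 t) measurableSet_Ioc (by simp) (1 : ℝ))
    (indicatorConstLp 2 (s := Ioc t 0) measurableSet_Ioc (by simp) (1 : ℝ))] with x h3 h4 h5
  rw [stepLp, h5, Pi.sub_apply, h3, h4]

@[simp]
theorem stepLp_zero : stepLp 0 = 0 := by
  simp [stepLp]

theorem inner_stepLp (t : ℝ) (f : Lp ℝ 2 (volume : Measure ℝ)) :
    inner ℝ (stepLp t) f = ∫ x in (0 : ℝ)..t, f x := by
  rw [stepLp, inner_sub_left, L2.inner_indicatorConstLp_one, L2.inner_indicatorConstLp_one,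
    intervalIntegral]

theorem inner_stepLp_stepLp_of_nonneg {s t : ℝ} (hs : 0 ≤ s) (ht : 0 ≤ t) :
    inner ℝ (stepLp s) (stepLp t) = min s t := by
  simp only [stepLp, inner_sub_left, inner_sub_right,
    L2.real_inner_indicatorConstLp_one_indicatorConstLp_one, Ioc_inter_Ioc, Real.volume_real_Ioc]
  grind

theorem inner_stepLp_stepLp_of_nonpos {s t : ℝ} (hs : s ≤ 0) (ht : t ≤ 0) :
    inner ℝ (stepLp s) (stepLp t) = min (-s) (-t) := by
  simp only [stepLp, inner_sub_left, inner_sub_right,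
    L2.real_inner_indicatorConstLp_one_indicatorConstLp_one, Ioc_inter_Ioc, Real.volume_real_Ioc]
  grind

theorem inner_stepLp_stepLp_of_nonneg_of_nonpos {s t : ℝ} (hs : 0 ≤ s) (ht : t ≤ 0) :
    inner ℝ (stepLp s) (stepLp t) = 0 := by
  simp only [stepLp, inner_sub_left, inner_sub_right,
    L2.real_inner_indicatorConstLp_one_indicatorConstLp_one, Ioc_inter_Ioc, Real.volume_real_Ioc]
  grind

/-- A function orthogonal to every signed indicator has vanishing primitive, so it is zero by
Lebesgue differentiation. -/
theorem denseRange_linearCombination_stepLp :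
    DenseRange (Finsupp.linearCombination ℝ stepLp) := by
  have h : (Submodule.span ℝ (range stepLp)).topologicalClosure = ⊤ := by
    rw [Submodule.topologicalClosure_eq_top_iff, eq_bot_iff]
    intro f hf
    rw [Submodule.mem_orthogonal] at hf
    have h0 : ∀ t, ∫ x in (0 : ℝ)..t, f x = 0 := fun t => by
      rw [← inner_stepLp]
      exact hf _ (Submodule.subset_span (mem_range_self t))
    rw [Submodule.mem_bot, Lp.eq_zero_iff_ae_eq_zero]
    have hloc : LocallyIntegrable f := (Lp.memLp f).locallyIntegrable one_le_two
    filter_upwards [LocallyIntegrable.ae_hasDerivAt_integral hloc] with x hx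
    have h1 := hx 0
    simp only [h0] at h1
    exact h1.unique (hasDerivAt_const x 0)
  rw [← Finsupp.range_linearCombination] at h
  exact Submodule.dense_iff_topologicalClosure_eq_top.2 h

theorem StepData.toFun_ae_eq (S : StepData) :
    (∑ i, S.c i • (stepLp (S.b i) - stepLp (S.a i)) : Lp ℝ 2 (volume : Measure ℝ)) =ᵐ[volume]
      S.toFun := by
  have h1 : ∀ᵐ x : ℝ, ∀ i, (S.c i • (stepLp (S.b i) - stepLp (S.a i))) x =
      S.c i * (Ioc (S.a i) (S.b i)).indicator (fun _ => (1 : ℝ)) x := by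
    rw [ae_all_iff]
    intro i
    filter_upwards [Lp.coeFn_smul (S.c i) (stepLp (S.b i) - stepLp (S.a i)),
      Lp.coeFn_sub (stepLp (S.b i)) (stepLp (S.a i)), coeFn_stepLp (S.b i),
      coeFn_stepLp (S.a i)] with x h2 h3 h4 h5
    rw [h2, Pi.smul_apply, h3, Pi.sub_apply, h4, h5, smul_eq_mul]
    congr 1
    have := S.le i
    simp only [indicator_apply, mem_Ioc]
    grind
  filter_upwards [h1, Lp.coeFn_finsetSum Finset.univ
    fun i => S.c i • (stepLp (S.b i) - stepLp (S.a i))] with x h2 h3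
  rw [h3, Finset.sum_apply, StepData.toFun]
  exact Finset.sum_congr rfl fun i _ => h2 i

theorem exists_stepData_eq_linearCombination (x : ℝ →₀ ℝ) : ∃ S : StepData,
    ∑ i, S.c i • (stepLp (S.b i) - stepLp (S.a i)) = Finsupp.linearCombination ℝ stepLp x := by
  let σ := x.support.equivFin
  -- Interval end points must be ordered, so a negative `t` contributes `(t, 0]` with the opposite
  -- coefficient.
  refine ⟨⟨x.support.card, fun i => min 0 (σ.symm i : ℝ), fun i => max 0 (σ.symm i : ℝ),
    fun i => if 0 ≤ (σ.symm i : ℝ) then x (σ.symm i) else -x (σ.symm i),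
    fun i => min_le_max⟩, ?_⟩
  have h1 : ∀ t : ℝ, (if 0 ≤ t then x t else -x t) • (stepLp (max 0 t) - stepLp (min 0 t)) =
      x t • stepLp t := by
    intro t
    rcases le_total 0 t with ht | ht
    · simp [ht]
    · rcases ht.eq_or_lt with rfl | ht'
      · simp
      · simp [ht, ht'.not_ge]
  simp only [h1]
  rw [σ.symm.sum_comp (fun t : x.support => x t • stepLp (t : ℝ)),
    Finset.sum_coe_sort x.support (fun t => x t • stepLp t), Finsupp.linearCombination_apply,
    Finsupp.sum]

end StepFunctions

/-! ### The Wiener integral as a map on L²(ℝ). -/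

section Wiener

variable {Ω : Type*} [MeasurableSpace Ω] {P : Measure Ω} {B : ℝ → Ω → ℝ}

namespace IsTwoSidedBrownian

theorem memLp (hB : IsTwoSidedBrownian B P) (t : ℝ) : MemLp (B t) 2 P := by
  rcases le_total 0 t with ht | ht
  · lift t to ℝ≥0 using ht
    exact (hB.right.isGaussianProcess.hasGaussianLaw_eval t).memLp_two
  · obtain ⟨r, rfl⟩ : ∃ r : ℝ≥0, t = -r := ⟨⟨-t, neg_nonneg.2 ht⟩, (neg_neg t).symm⟩
    exact (hB.left.isGaussianProcess.hasGaussianLaw_eval r).memLp_two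

theorem integral_mul_coe [IsProbabilityMeasure P] (hB : IsTwoSidedBrownian B P) (s t : ℝ≥0) :
    ∫ ω, B s ω * B t ω ∂P = min (s : ℝ) t := by
  have h := hB.right.covariance_eval s t
  rw [covariance_eq_sub (hB.memLp s) (hB.memLp t), hB.right.integral_eval s, zero_mul,
    sub_zero] at h
  exact h.trans (NNReal.coe_min s t)

theorem integral_mul_neg_coe [IsProbabilityMeasure P] (hB : IsTwoSidedBrownian B P) (s t : ℝ≥0) :
    ∫ ω, B (-s) ω * B (-t) ω ∂P = min (s : ℝ) t := by
  have h := hB.left.covariance_eval s t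
  rw [covariance_eq_sub (hB.memLp (-s)) (hB.memLp (-t)), hB.left.integral_eval s, zero_mul,
    sub_zero] at h
  exact h.trans (NNReal.coe_min s t)

theorem integral_coe_mul_neg_coe (hB : IsTwoSidedBrownian B P) (s t : ℝ≥0) :
    ∫ ω, B s ω * B (-t) ω ∂P = 0 := by
  have h := hB.indep.comp (measurable_pi_apply s) (measurable_pi_apply t)
  have h2 := h.integral_fun_mul_eq_mul_integral (hB.memLp s).1 (hB.memLp (-t)).1
  have h3 : ∫ ω, B s ω ∂P = 0 := hB.right.integral_eval s
  exact h2.trans (by simp [h3])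

/-- On each half-line both Gram matrices are the minimum of absolute values. Across the origin both
vanish: by independence and centring for `B`, by disjoint supports for the indicators. -/
theorem inner_toLp_eq_inner_stepLp [IsProbabilityMeasure P] (hB : IsTwoSidedBrownian B P)
    (s t : ℝ) :
    inner ℝ (hB.memLp s).toLp (hB.memLp t).toLp = inner ℝ (stepLp s) (stepLp t) := by
  have h : ∀ s t, inner ℝ (hB.memLp s).toLp (hB.memLp t).toLp = ∫ ω, B s ω * B t ω ∂P := by
    intro s t
    rw [L2.inner_def]
    refine integral_congr_ae ?_
    filter_upwards [(hB.memLp s).coeFn_toLp, (hB.memLp t).coeFn_toLp] with ω h1 h2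
    simp [h1, h2, mul_comm]
  have hneg : ∀ r : ℝ, r ≤ 0 → ∃ q : ℝ≥0, r = -q := fun r hr =>
    ⟨⟨-r, neg_nonneg.2 hr⟩, (neg_neg r).symm⟩
  rcases le_total 0 s with hs | hs <;> rcases le_total 0 t with ht | ht
  · rw [h, inner_stepLp_stepLp_of_nonneg hs ht]
    lift s to ℝ≥0 using hs
    lift t to ℝ≥0 using ht
    exact hB.integral_mul_coe s t
  · rw [h, inner_stepLp_stepLp_of_nonneg_of_nonpos hs ht]
    lift s to ℝ≥0 using hs
    obtain ⟨t, rfl⟩ := hneg t ht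
    exact hB.integral_coe_mul_neg_coe s t
  · rw [real_inner_comm, h, real_inner_comm, inner_stepLp_stepLp_of_nonneg_of_nonpos ht hs]
    lift t to ℝ≥0 using ht
    obtain ⟨s, rfl⟩ := hneg s hs
    exact hB.integral_coe_mul_neg_coe t s
  · rw [h, inner_stepLp_stepLp_of_nonpos hs ht]
    obtain ⟨s, rfl⟩ := hneg s hs
    obtain ⟨t, rfl⟩ := hneg t ht
    rw [neg_neg, neg_neg]
    exact hB.integral_mul_neg_coe s t

/-- The Wiener integral is a continuous linear map `L²(ℝ) → L²(P)`. -/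
theorem exists_wienerMap [IsProbabilityMeasure P] (hB : IsTwoSidedBrownian B P) :
    ∃ W : Lp ℝ 2 (volume : Measure ℝ) →L[ℝ] Lp ℝ 2 P,
      (∀ t, W (stepLp t) =ᵐ[P] B t) ∧
      ∀ (f : ℝ → ℝ) (hf : MemLp f 2 volume) (X : Ω → ℝ),
        IsWienerIntegral B P f X ↔ X =ᵐ[P] W hf.toLp := by
  obtain ⟨W, hW⟩ := exists_continuousLinearMap_of_inner_eq (hB.inner_toLp_eq_inner_stepLp)
    denseRange_linearCombination_stepLp
  have hWS : ∀ S : StepData, W (∑ i, S.c i • (stepLp (S.b i) - stepLp (S.a i))) =ᵐ[P]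
      S.integral B := by
    intro S
    have h1 : ∀ᵐ ω ∂P, ∀ i, (S.c i • ((hB.memLp (S.b i)).toLp - (hB.memLp (S.a i)).toLp)) ω =
        S.c i * (B (S.b i) ω - B (S.a i) ω) := by
      rw [ae_all_iff]
      intro i
      filter_upwards [Lp.coeFn_smul (S.c i) ((hB.memLp (S.b i)).toLp - (hB.memLp (S.a i)).toLp),
        Lp.coeFn_sub (hB.memLp (S.b i)).toLp (hB.memLp (S.a i)).toLp,
        (hB.memLp (S.b i)).coeFn_toLp, (hB.memLp (S.a i)).coeFn_toLp] with x h2 h3 h4 h5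
      rw [h2, Pi.smul_apply, h3, Pi.sub_apply, h4, h5, smul_eq_mul]
    simp only [map_sum, map_smul, map_sub, hW]
    filter_upwards [h1, Lp.coeFn_finsetSum Finset.univ
      fun i => S.c i • ((hB.memLp (S.b i)).toLp - (hB.memLp (S.a i)).toLp)] with x h2 h3
    rw [h3, Finset.sum_apply, StepData.integral]
    exact Finset.sum_congr rfl fun i _ => h2 i
  have hnorm : ∀ (S : ℕ → StepData) (f : ℝ → ℝ) (hf : MemLp f 2 volume),
      Tendsto (fun n => eLpNorm (fun x => (S n).toFun x - f x) 2 volume) atTop (𝓝 0) ↔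
      Tendsto (fun n => ∑ i, (S n).c i • (stepLp ((S n).b i) - stepLp ((S n).a i))) atTop
        (𝓝 hf.toLp) := by
    intro S f hf
    rw [Lp.tendsto_Lp_iff_tendsto_eLpNorm']
    refine tendsto_congr fun n => eLpNorm_congr_ae ?_
    filter_upwards [(S n).toFun_ae_eq, hf.coeFn_toLp] with x h1 h2
    rw [Pi.sub_apply, h1, h2]
  have hnorm' : ∀ (S : ℕ → StepData) (X : Ω → ℝ) (hX : MemLp X 2 P),
      Tendsto (fun n => eLpNorm (fun ω => (S n).integral B ω - X ω) 2 P) atTop (𝓝 0) ↔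
      Tendsto (fun n => W (∑ i, (S n).c i • (stepLp ((S n).b i) - stepLp ((S n).a i)))) atTop
        (𝓝 hX.toLp) := by
    intro S X hX
    rw [Lp.tendsto_Lp_iff_tendsto_eLpNorm']
    refine tendsto_congr fun n => eLpNorm_congr_ae ?_
    filter_upwards [hWS (S n), hX.coeFn_toLp] with x h1 h2
    rw [Pi.sub_apply, h1, h2]
  refine ⟨W, fun t => by rw [hW]; exact (hB.memLp t).coeFn_toLp, fun f hf X => ⟨?_, fun h => ?_⟩⟩
  · rintro ⟨-, hX, S, hS, hS'⟩
    rw [hnorm S f hf] at hS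
    rw [hnorm' S X hX] at hS'
    -- The approximating sequence is irrelevant: continuity of `W` forces its limit.
    rw [← tendsto_nhds_unique hS' ((W.continuous.tendsto _).comp hS)]
    exact hX.coeFn_toLp.symm
  · have hX : MemLp X 2 P := (Lp.memLp (W hf.toLp)).ae_eq h.symm
    have hXW : hX.toLp = W hf.toLp := Lp.ext (hX.coeFn_toLp.trans h)
    obtain ⟨v, hv, hv'⟩ := mem_closure_iff_seq_limit.1
      (denseRange_linearCombination_stepLp hf.toLp)
    choose x hx using hv
    choose S hS using fun n => exists_stepData_eq_linearCombination (x n)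
    have hSv : Tendsto (fun n => ∑ i, (S n).c i • (stepLp ((S n).b i) - stepLp ((S n).a i)))
        atTop (𝓝 hf.toLp) := by
      simpa only [hS, hx] using hv'
    refine ⟨hf, hX, S, (hnorm S f hf).2 hSv, (hnorm' S X hX).2 ?_⟩
    rw [hXW]
    exact (W.continuous.tendsto _).comp hSv

end IsTwoSidedBrownian

end Wiener

/-! ### Jointly measurable versions. -/

section MeasurableVersion

variable {α : Type*} [MeasurableSpace α] {μ : Measure α}

/-- Summable errors force almost everywhere convergence of the whole sequence; a subsequence from
convergence in measure identifies the limit. -/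
theorem ae_tendsto_of_norm_sub_le {f : ℕ → Lp ℝ 2 μ} {g : Lp ℝ 2 μ}
    (h : ∀ n, ‖f n - g‖ ≤ (1 / 2) ^ n) :
    ∀ᵐ x ∂μ, Tendsto (fun n => f n x) atTop (𝓝 (g x)) := by
  have hlim : Tendsto f atTop (𝓝 g) :=
    tendsto_iff_norm_sub_tendsto_zero.2 (squeeze_zero (fun _ => norm_nonneg _) h
      (tendsto_pow_atTop_nhds_zero_of_lt_one (by norm_num) (by norm_num)))
  obtain ⟨ns, hns, hsub⟩ := (tendstoInMeasure_of_tendsto_Lp hlim).exists_seq_tendsto_ae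
  have hconv : ∀ᵐ x ∂μ, ∃ l : ℝ, Tendsto (fun n => f n x) atTop (𝓝 l) := by
    refine Lp.ae_tendsto_of_cauchy_eLpNorm (p := 2) (fun n => Lp.aestronglyMeasurable _)
      -- The triangle inequality gives `2 * (1 / 2) ^ N`; the factor `3` makes the bound strict.
      one_le_two (B := fun N => ENNReal.ofReal (3 * (1 / 2) ^ N))
      ((summable_geometric_of_lt_one (by norm_num) (by norm_num)).mul_left 3).tsum_ofReal_ne_top
      fun N n k hn hk => ?_
    have h1 : ‖f n - f k‖ < 3 * (1 / 2) ^ N := by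
      have h2 : ∀ j, N ≤ j → ‖f j - g‖ ≤ (1 / 2) ^ N := fun j hj =>
        (h j).trans (pow_le_pow_of_le_one (by norm_num) (by norm_num) hj)
      have h3 : ‖f n - f k‖ ≤ ‖f n - g‖ + ‖f k - g‖ := by
        rw [← norm_neg (f k - g)]
        refine le_trans (le_of_eq ?_) (norm_add_le _ _)
        congr 1
        abel
      have h4 : (0 : ℝ) < (1 / 2) ^ N := by positivity
      linarith [h2 n hn, h2 k hk]
    rw [← eLpNorm_congr_ae (Lp.coeFn_sub (f n) (f k)), ← Lp.enorm_def, ← ofReal_norm]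
    exact (ENNReal.ofReal_lt_ofReal_iff (by positivity)).2 h1
  filter_upwards [hsub, hconv] with x h1 h2
  obtain ⟨l, hl⟩ := h2
  rwa [tendsto_nhds_unique h1 (hl.comp hns.tendsto_atTop)]

/-- A uniformly `L²`-continuous process has a jointly measurable version. -/
theorem exists_measurable_version {X : ℝ → Lp ℝ 2 μ} (hX : UniformContinuous X) :
    ∃ ξ : ℝ → α → ℝ, Measurable (fun p : ℝ × α => ξ p.1 p.2) ∧ ∀ u, ξ u =ᵐ[μ] X u := by
  have hδ : ∀ n : ℕ, ∃ δ > (0 : ℝ), ∀ u v, dist u v < δ → ‖X u - X v‖ < (1 / 2) ^ n := by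
    intro n
    obtain ⟨δ, hδ, h⟩ := Metric.uniformContinuous_iff.1 hX ((1 / 2) ^ n) (by positivity)
    exact ⟨δ, hδ, fun u v huv => by rw [← dist_eq_norm]; exact h huv⟩
  choose δ hδ hX using hδ
  -- Sampling on the grid `δ n * ℤ` involves only countably many classes, so joint measurability
  -- holds.
  let η : ℕ → ℝ → α → ℝ := fun n u ω => X (δ n * ⌊u / δ n⌋) ω
  have hη : ∀ n, Measurable fun p : ℝ × α => η n p.1 p.2 := by
    intro n
    have h1 : Measurable fun q : ℤ × α => X (δ n * q.1) q.2 :=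
      measurable_from_prod_countable_right fun k =>
      (Lp.stronglyMeasurable (X (δ n * k))).measurable
    exact h1.comp ((Int.measurable_floor.comp (measurable_fst.div_const _)).prodMk measurable_snd)
  -- The `limsup` is measurable whether or not the sequence converges, and is the limit when it
  -- does.
  refine ⟨fun u ω => limsup (fun n => η n u ω) atTop, Measurable.limsup hη, fun u => ?_⟩
  have h := ae_tendsto_of_norm_sub_le (f := fun n => X (δ n * ⌊u / δ n⌋)) (g := X u) fun n => by
    refine (hX n _ _ ?_).le
    have h1 := Int.fract_nonneg (u / δ n)
    have h2 := Int.fract_lt_one (u / δ n)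
    have h3 : u - δ n * ⌊u / δ n⌋ = δ n * Int.fract (u / δ n) := by
      rw [Int.fract, mul_sub, mul_div_cancel₀ _ (hδ n).ne']
    rw [dist_comm, Real.dist_eq, h3, abs_of_nonneg (mul_nonneg (hδ n).le h1)]
    exact mul_lt_of_lt_one_right (hδ n) h2
  filter_upwards [h] with ω hω
  exact hω.limsup_eq

end MeasurableVersion

/-- Since `T_u f - T_v f = T_v (T_{u-v} f - f)` and `T_v` is isometric, the modulus of continuity at
`0` serves everywhere. -/
theorem uniformContinuous_translateLp {E : Type*} [NormedAddCommGroup E]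
    (f : Lp E 2 (volume : Measure ℝ)) : UniformContinuous fun u => translateLp u f := by
  refine Metric.uniformContinuous_iff.2 fun ε hε => ?_
  obtain ⟨δ, hδ, h⟩ := Metric.continuous_iff.1 (continuous_translateLp f) 0 ε hε
  refine ⟨δ, hδ, fun {u v} huv => ?_⟩
  have h0 : translateLp u f - translateLp v f =
      translateLp v (translateLp (u - v) f - translateLp 0 f) := by
    rw [map_sub, translateLp_translateLp, translateLp_translateLp, add_sub_cancel, add_zero]
  rw [dist_eq_norm, h0, norm_translateLp, ← dist_eq_norm]
  exact h _ (by rwa [Real.dist_eq, sub_zero, ← Real.dist_eq])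

theorem exists_isWaveletTransform {Ω : Type*} [MeasurableSpace Ω] {P : Measure Ω}
    {B : ℝ → Ω → ℝ} {W : Lp ℝ 2 (volume : Measure ℝ) →L[ℝ] Lp ℝ 2 P}
    (hW : ∀ (f : ℝ → ℝ) (hf : MemLp f 2 volume) (X : Ω → ℝ),
      IsWienerIntegral B P f X ↔ X =ᵐ[P] W hf.toLp)
    {g : ℝ → ℝ} (hg : MemLp g 2 volume) : ∃ ξ, IsWaveletTransform B P g ξ := by
  obtain ⟨ξ, hξ, h⟩ := exists_measurable_version
    (W.uniformContinuous.comp (uniformContinuous_translateLp hg.toLp))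
  exact ⟨ξ, hξ, fun u => (hW _ (memLp_comp_sub_right hg u) _).2 (h u)⟩

/-! ### Fubini on a single path. -/

section Pathwise

variable {g x : ℝ → ℝ}

theorem inner_stepLp_translateLp (hg : MemLp g 2 volume) (t u : ℝ) :
    inner ℝ (stepLp t) (translateLp u hg.toLp) = ∫ s in (0 : ℝ)..t, g (s - u) := by
  rw [inner_stepLp]
  refine intervalIntegral.integral_congr_ae_restrict (ae_restrict_of_ae ?_)
  exact (memLp_comp_sub_right hg u).coeFn_toLp

theorem intervalIntegrable_mul_comp_sub (hg : MemLp g 2 volume) {A : ℝ} (hA : 0 < A)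
    (hx : MemLp x 2 (volume.restrict (Ioc (-A) A))) (s : ℝ) :
    IntervalIntegrable (fun u => x u * g (s - u)) volume (-A) A := by
  rw [intervalIntegrable_iff_integrableOn_Ioc_of_le (by linarith)]
  exact hx.integrable_mul
    ((hg.comp_measurePreserving (Measure.measurePreserving_sub_left volume s)).restrict _)

theorem integrable_prod_mul_comp_sub (hg : MemLp g 2 volume) {A : ℝ}
    (hx : MemLp x 2 (volume.restrict (Ioc (-A) A))) (t : ℝ) :
    Integrable (fun p : ℝ × ℝ => x p.2 * g (p.1 - p.2))
      ((volume.restrict (uIoc 0 t)).prod (volume.restrict (Ioc (-A) A))) := by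
  have hgm : AEStronglyMeasurable (fun p : ℝ × ℝ => g (p.1 - p.2))
      ((volume.restrict (uIoc 0 t)).prod (volume.restrict (Ioc (-A) A))) := by
    rw [Measure.prod_restrict]
    exact (hg.1.comp_quasiMeasurePreserving
      (quasiMeasurePreserving_sub_of_right_invariant volume volume)).restrict
  have hfin : volume (uIoc 0 t) ≠ ∞ := by simp [uIoc]
  have hm : AEStronglyMeasurable (fun p : ℝ × ℝ => x p.2 * g (p.1 - p.2))
      ((volume.restrict (uIoc 0 t)).prod (volume.restrict (Ioc (-A) A))) :=
    hx.1.comp_snd.mul hgm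
  rw [integrable_prod_iff' hm]
  have hgu : ∀ u, MemLp (fun s => g (s - u)) 2 (volume.restrict (uIoc 0 t)) := fun u =>
    (memLp_comp_sub_right hg u).restrict _
  have : IsFiniteMeasure (volume.restrict (uIoc 0 t)) := ⟨by simp⟩
  constructor
  · exact .of_forall fun u => ((hgu u).integrable one_le_two).const_mul (x u)
  · refine Integrable.mono' ((hx.integrable one_le_two).norm.mul_const
      (‖indicatorConstLp 2 (measurableSet_uIoc (a := 0) (b := t)) hfin (1 : ℝ)‖ * ‖hg.toLp‖))
      hm.norm.prod_swap.integral_prod_right' (.of_forall fun u => ?_)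
    rw [Real.norm_of_nonneg (integral_nonneg fun _ => norm_nonneg _)]
    simp only [norm_mul]
    rw [integral_const_mul]
    refine mul_le_mul_of_nonneg_left ?_ (norm_nonneg _)
    have h := setIntegral_norm_le_norm_Lp_two (measurableSet_uIoc (a := 0) (b := t)) hfin
      (translateLp u hg.toLp)
    rw [norm_translateLp] at h
    refine (le_of_eq ?_).trans h
    refine integral_congr_ae (ae_restrict_of_ae ?_)
    filter_upwards [(memLp_comp_sub_right hg u).coeFn_toLp] with s hs
    rw [← hs]
    rfl

theorem intervalIntegrable_integral_mul_comp_sub (hg : MemLp g 2 volume) {A : ℝ} (hA : 0 < A)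
    (hx : MemLp x 2 (volume.restrict (Ioc (-A) A))) (t : ℝ) :
    IntervalIntegrable (fun s => ∫ u in (-A)..A, x u * g (s - u)) volume 0 t := by
  rw [intervalIntegrable_iff]
  simp only [intervalIntegral.integral_of_le (show -A ≤ A by linarith)]
  exact (integrable_prod_mul_comp_sub hg hx t).integral_prod_left

/-- After exchanging the integrals, the integral over `s` is exactly the coefficient `⟨1_t, T_u g⟩`.
-/
theorem integral_integral_mul_comp_sub (hg : MemLp g 2 volume) {A : ℝ} (hA : 0 < A)
    (hx : MemLp x 2 (volume.restrict (Ioc (-A) A))) (t : ℝ) :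
    ∫ s in (0 : ℝ)..t, ∫ u in (-A)..A, x u * g (s - u) =
      ∫ u in (-A)..A, inner ℝ (stepLp t) (translateLp u hg.toLp) * x u := by
  simp only [intervalIntegral.integral_of_le (show -A ≤ A by linarith), inner_stepLp_translateLp,
    intervalIntegral.intervalIntegral_eq_integral_uIoc _ 0 t]
  rw [integral_integral_swap (integrable_prod_mul_comp_sub hg hx t), ← integral_smul]
  refine integral_congr_ae (.of_forall fun u => ?_)
  simp only [integral_const_mul, smul_eq_mul]
  ring

end Pathwise

/-! ### From paths to the Wiener map. -/

section Stochastic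

variable {Ω : Type*} [MeasurableSpace Ω] {P : Measure Ω} [IsProbabilityMeasure P]

/-- By Tonelli, `E ∫_{-n}^n ξ(u)² du ≤ 2 n C²` is finite. Using integers `n` yields one null set for
all `A`. -/
theorem ae_memLp_two_restrict {X : ℝ → Lp ℝ 2 P} {C : ℝ} (hX : ∀ u, ‖X u‖ ≤ C)
    {ξ : ℝ → Ω → ℝ} (hξ : Measurable fun p : ℝ × Ω => ξ p.1 p.2) (h : ∀ u, ξ u =ᵐ[P] X u) :
    ∀ᵐ ω ∂P, ∀ A : ℝ, MemLp (fun u => ξ u ω) 2 (volume.restrict (Ioc (-A) A)) := by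
  have hn : ∀ n : ℕ, ∀ᵐ ω ∂P, MemLp (fun u => ξ u ω) 2 (volume.restrict (Ioc (-n : ℝ) n)) := by
    intro n
    have hm : Measurable fun p : Ω × ℝ => ‖ξ p.2 p.1‖ₑ ^ (2 : ℝ) :=
      ((hξ.comp measurable_swap).enorm).pow_const _
    have h1 : ∀ u, ∫⁻ ω, ‖ξ u ω‖ₑ ^ (2 : ℝ) ∂P ≤ ENNReal.ofReal C ^ (2 : ℝ) := by
      intro u
      have h2 : eLpNorm (ξ u) 2 P ≤ ENNReal.ofReal C := by
        rw [eLpNorm_congr_ae (h u), ← Lp.enorm_def, ← ofReal_norm]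
        exact ENNReal.ofReal_le_ofReal (hX u)
      rw [eLpNorm_eq_lintegral_rpow_enorm_toReal (p := 2) (by simp) (by simp)] at h2
      have h3 := ENNReal.rpow_le_rpow h2 (z := 2) (by norm_num)
      rw [← ENNReal.rpow_mul] at h3
      simpa using h3
    have h4 : ∫⁻ ω, (∫⁻ u in Ioc (-n : ℝ) n, ‖ξ u ω‖ₑ ^ (2 : ℝ)) ∂P ≠ ∞ := by
      rw [lintegral_lintegral_swap hm.aemeasurable]
      refine ((lintegral_mono h1).trans_lt ?_).ne
      rw [lintegral_const]
      refine ENNReal.mul_lt_top (ENNReal.rpow_lt_top_of_nonneg (by norm_num)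
        ENNReal.ofReal_ne_top) (by simp)
    filter_upwards [ae_lt_top hm.lintegral_prod_right' h4] with ω hω
    refine ⟨(hξ.comp measurable_prodMk_right).aestronglyMeasurable, ?_⟩
    rw [eLpNorm_lt_top_iff_lintegral_rpow_enorm_lt_top (by simp) (by simp)]
    simpa using hω
  filter_upwards [ae_all_iff.2 hn] with ω hω A
  obtain ⟨n, hn⟩ := exists_nat_ge A
  refine (hω n).mono_measure (Measure.restrict_mono ?_ le_rfl)
  exact Ioc_subset_Ioc (neg_le_neg hn) hn

variable {B : ℝ → Ω → ℝ} {W : Lp ℝ 2 (volume : Measure ℝ) →L[ℝ] Lp ℝ 2 P} {g : ℝ → ℝ}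
  {ξ : ℝ → Ω → ℝ}

/-- Both sides equal `∫_{-A}^A ⟨1_t, T_u g⟩ ξ(u) du`: the left by pathwise Fubini, the right because
`W` commutes with Bochner integrals, which can be computed pointwise. -/
theorem truncConvIntegral_ae_eq
    (hW : ∀ (f : ℝ → ℝ) (hf : MemLp f 2 volume) (X : Ω → ℝ),
      IsWienerIntegral B P f X ↔ X =ᵐ[P] W hf.toLp)
    (hg : MemLp g 2 volume) (hξ : IsWaveletTransform B P g ξ) (t : ℝ) {A : ℝ} (hA : 0 < A) :
    truncConvIntegral g ξ t A =ᵐ[P]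
      W (∫ u in (-A)..A, inner ℝ (stepLp t) (translateLp u hg.toLp) • translateLp u hg.toLp) := by
  have hX : ∀ u, ξ u =ᵐ[P] W (translateLp u hg.toLp) := fun u =>
    (hW _ (memLp_comp_sub_right hg u) _).1 (hξ.wiener u)
  have hcont : Continuous fun u => inner ℝ (stepLp t) (translateLp u hg.toLp) :=
    continuous_inner_translateLp _ _
  have hAA : -A ≤ A := by linarith
  have hint : IntervalIntegrable (fun u => inner ℝ (stepLp t) (translateLp u hg.toLp) •
      translateLp u hg.toLp) volume (-A) A :=
    (hcont.smul (continuous_translateLp hg.toLp)).intervalIntegrable _ _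
  have hbdd : ∀ u, ‖W (translateLp u hg.toLp)‖ ≤ ‖W‖ * ‖hg.toLp‖ := fun u =>
    (W.le_opNorm _).trans_eq (by rw [norm_translateLp])
  have h1 := coeFn_integral_Lp_two (μ := P) (ν := volume.restrict (Ioc (-A) A))
    (X := fun u => inner ℝ (stepLp t) (translateLp u hg.toLp) • W (translateLp u hg.toLp))
    (ξ := fun u ω => inner ℝ (stepLp t) (translateLp u hg.toLp) * ξ u ω)
    ((hcont.smul (W.continuous.comp (continuous_translateLp hg.toLp))).integrableOn_Ioc)
    ((hcont.measurable.comp measurable_fst).mul hξ.measurable).aestronglyMeasurable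
    (.of_forall fun u => by
      filter_upwards [hX u, Lp.coeFn_smul (inner ℝ (stepLp t) (translateLp u hg.toLp))
        (W (translateLp u hg.toLp))] with ω h2 h3
      rw [h3, Pi.smul_apply, h2, smul_eq_mul])
  rw [← W.intervalIntegral_comp_comm hint, intervalIntegral.integral_of_le hAA]
  simp only [map_smul]
  filter_upwards [h1, ae_memLp_two_restrict hbdd hξ.measurable hX] with ω h2 h3
  rw [h2, truncConvIntegral, integral_integral_mul_comp_sub hg hA (h3 A),
    intervalIntegral.integral_of_le hAA]

theorem isConvIntegral_of_wienerMap
    (hW : ∀ (f : ℝ → ℝ) (hf : MemLp f 2 volume) (X : Ω → ℝ),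
      IsWienerIntegral B P f X ↔ X =ᵐ[P] W hf.toLp)
    (hg : MemLp g 2 volume) (hξ : IsWaveletTransform B P g ξ)
    {m : Lp ℂ ∞ (volume : Measure ℝ)}
    (hm : m =ᵐ[volume] (𝓕 (ofRealLp hg.toLp) : Lp ℂ 2 (volume : Measure ℝ))) (t : ℝ) :
    IsConvIntegral P g ξ t
      (W (reLp (convOp m (ContinuousLinearMap.adjoint (convOp m) (ofRealLp (stepLp t)))))) := by
  have hX : ∀ u, ξ u =ᵐ[P] W (translateLp u hg.toLp) := fun u =>
    (hW _ (memLp_comp_sub_right hg u) _).1 (hξ.wiener u)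
  have hbdd : ∀ u, ‖W (translateLp u hg.toLp)‖ ≤ ‖W‖ * ‖hg.toLp‖ := fun u =>
    (W.le_opNorm _).trans_eq (by rw [norm_translateLp])
  have hpath := ae_memLp_two_restrict hbdd hξ.measurable hX
  refine ⟨?_, ?_, fun A hA => ?_, Lp.memLp _, ?_⟩
  · filter_upwards [hpath] with ω hω A hA s
    exact intervalIntegrable_mul_comp_sub hg hA (hω A) s
  · filter_upwards [hpath] with ω hω A hA
    exact intervalIntegrable_integral_mul_comp_sub hg hA (hω A) t
  · exact (Lp.memLp _).ae_eq (truncConvIntegral_ae_eq hW hg hξ t hA).symm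
  · have h := (W.continuous.tendsto _).comp
      (tendsto_integral_inner_smul_translateLp (stepLp t) hm)
    rw [Lp.tendsto_Lp_iff_tendsto_eLpNorm'] at h
    refine h.congr' ?_
    filter_upwards [eventually_gt_atTop 0] with A hA
    refine eLpNorm_congr_ae ?_
    filter_upwards [truncConvIntegral_ae_eq hW hg hξ t hA] with ω hω
    rw [Pi.sub_apply, hω, Function.comp_apply]

end Stochastic

/-! ### Resolution of the identity in frequency. -/

section LittlewoodPaley

/-- In frequency the partial sums multiply `𝓕 f` by scalars in `[0, 1]` increasing to `1`; dominated
convergence and Plancherel finish. -/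
theorem tendsto_convOp_adjoint_sum {m : Lp ℂ ∞ (volume : Measure ℝ)}
    {mj : ℕ → Lp ℂ ∞ (volume : Measure ℝ)}
    (h : ∀ᵐ x : ℝ, HasSum (fun j => (2 : ℝ) ^ j * ‖mj j x‖ ^ 2) (1 - ‖m x‖ ^ 2))
    (f : Lp ℂ 2 (volume : Measure ℝ)) :
    Tendsto (fun N => convOp m (ContinuousLinearMap.adjoint (convOp m) f) +
      ∑ j ∈ Finset.range N,
        (2 : ℝ) ^ j • convOp (mj j) (ContinuousLinearMap.adjoint (convOp (mj j)) f))
      atTop (𝓝 f) := by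
  set S : ℕ → Lp ℂ 2 (volume : Measure ℝ) := fun N =>
    convOp m (ContinuousLinearMap.adjoint (convOp m) f) + ∑ j ∈ Finset.range N,
      (2 : ℝ) ^ j • convOp (mj j) (ContinuousLinearMap.adjoint (convOp (mj j)) f) with hS
  have hcoe : ∀ N, (𝓕 (S N) : Lp ℂ 2 (volume : Measure ℝ)) =ᵐ[volume] fun x =>
      ((‖m x‖ ^ 2 + ∑ j ∈ Finset.range N, (2 : ℝ) ^ j * ‖mj j x‖ ^ 2 : ℝ) : ℂ) *
        (𝓕 f : Lp ℂ 2 (volume : Measure ℝ)) x := by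
    intro N
    induction N with
    | zero => simpa [hS] using coeFn_fourier_convOp_adjoint m f
    | succ N ih =>
      have h1 : 𝓕 (S (N + 1)) = 𝓕 (S N) + (2 : ℝ) ^ N •
          𝓕 (convOp (mj N) (ContinuousLinearMap.adjoint (convOp (mj N)) f)) := by
        simp only [hS, Finset.sum_range_succ, ← add_assoc]
        change Lp.fourierTransformₗᵢ ℝ ℂ _ = _
        rw [map_add]
        congr 1
        exact LinearMap.map_smul_of_tower (Lp.fourierTransformₗᵢ ℝ ℂ).toLinearEquiv.toLinearMap _ _
      rw [h1]
      filter_upwards [ih, coeFn_fourier_convOp_adjoint (mj N) f,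
        Lp.coeFn_add (𝓕 (S N)) ((2 : ℝ) ^ N •
          𝓕 (convOp (mj N) (ContinuousLinearMap.adjoint (convOp (mj N)) f))),
        Lp.coeFn_smul ((2 : ℝ) ^ N)
          (𝓕 (convOp (mj N) (ContinuousLinearMap.adjoint (convOp (mj N)) f)))]
        with x h2 h3 h4 h5
      rw [h4, Pi.add_apply, h5, Pi.smul_apply, h2, h3, Finset.sum_range_succ, Complex.real_smul]
      push_cast
      ring
  have hlim : Tendsto (fun N => 𝓕 (S N)) atTop (𝓝 (𝓕 f)) := by
    rw [Lp.tendsto_Lp_iff_tendsto_eLpNorm']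
    have hdiff : ∀ N, (fun x => (𝓕 (S N) : Lp ℂ 2 (volume : Measure ℝ)) x -
        (𝓕 f : Lp ℂ 2 (volume : Measure ℝ)) x) =ᵐ[volume] fun x =>
        ((∑ j ∈ Finset.range N, (2 : ℝ) ^ j * ‖mj j x‖ ^ 2 - (1 - ‖m x‖ ^ 2) : ℝ) : ℂ) *
          (𝓕 f : Lp ℂ 2 (volume : Measure ℝ)) x := by
      intro N
      filter_upwards [hcoe N] with x hx
      rw [hx]
      push_cast
      ring
    refine tendsto_eLpNorm_two_zero_of_dominated
      (bound := fun x => ‖(𝓕 f : Lp ℂ 2 (volume : Measure ℝ)) x‖)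
      (fun N => (Lp.aestronglyMeasurable _).sub (Lp.aestronglyMeasurable _))
      (Lp.memLp _).norm (fun N => ?_) ?_
    · filter_upwards [hdiff N, h] with x h1 h2
      rw [Pi.sub_apply, h1, norm_mul, Complex.norm_real]
      refine mul_le_of_le_one_left (norm_nonneg _) ?_
      have h3 : ∑ j ∈ Finset.range N, (2 : ℝ) ^ j * ‖mj j x‖ ^ 2 ≤ 1 - ‖m x‖ ^ 2 :=
        sum_le_hasSum _ (fun j _ => by positivity) h2
      have h4 : 0 ≤ ∑ j ∈ Finset.range N, (2 : ℝ) ^ j * ‖mj j x‖ ^ 2 :=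
        Finset.sum_nonneg fun j _ => by positivity
      -- The partial sum and `1 - ‖m x‖ ^ 2` both lie in `[0, 1]`, so they differ by at most `1`.
      rw [Real.norm_eq_abs, abs_le]
      constructor <;> nlinarith [sq_nonneg ‖m x‖]
    · filter_upwards [ae_all_iff.2 hdiff, h] with x h1 h2
      have h3 := h2.tendsto_sum_nat.sub_const (1 - ‖m x‖ ^ 2)
      rw [sub_self] at h3
      have h4 := ((Complex.continuous_ofReal.tendsto 0).comp h3).mul_const
        ((𝓕 f : Lp ℂ 2 (volume : Measure ℝ)) x)
      rw [Complex.ofReal_zero, zero_mul] at h4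
      refine h4.congr fun N => ?_
      rw [Pi.sub_apply, h1 N, Function.comp_apply]
  have h5 := ((Lp.fourierTransformₗᵢ ℝ ℂ).symm.continuous.tendsto _).comp hlim
  have h6 : ∀ F : Lp ℂ 2 (volume : Measure ℝ), (Lp.fourierTransformₗᵢ ℝ ℂ).symm (𝓕 F) = F :=
    (Lp.fourierTransformₗᵢ ℝ ℂ).symm_apply_apply
  simpa only [Function.comp_def, h6] using h5

theorem ae_comp_mul_left {c : ℝ} (hc : c ≠ 0) {p : ℝ → Prop} (h : ∀ᵐ x : ℝ, p x) :
    ∀ᵐ x : ℝ, p (c * x) := by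
  have hq : Measure.QuasiMeasurePreserving (fun x : ℝ => c * x) volume volume := by
    refine ⟨by fun_prop, ?_⟩
    rw [Real.map_volume_mul_left hc]
    exact Measure.smul_absolutelyContinuous
  exact hq.ae h

theorem exists_Lp_top_of_norm_le_one {F : Lp ℂ 2 (volume : Measure ℝ)}
    (h : ∀ᵐ x, ‖F x‖ ≤ 1) : ∃ m : Lp ℂ ∞ (volume : Measure ℝ), m =ᵐ[volume] F :=
  ⟨(memLp_top_of_bound (Lp.aestronglyMeasurable F) 1 h).toLp, MemLp.coeFn_toLp _⟩

/-- Nonnegativity of all terms, with weights `2 ^ j ≥ 1`, bounds each symbol by `1`. Rescaling by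
`2π` converts angular frequency to that of `𝓕`. -/
theorem exists_symbols {φ ψ : ℝ → ℝ} (hφ : MemLp φ 2 (volume : Measure ℝ))
    (hψ : MemLp ψ 2 (volume : Measure ℝ))
    (hLP : ∀ᵐ l : ℝ, HasSum
      (fun j : ℕ => (2 : ℝ) ^ j * ‖fourierL2 (dyadicDilate j ψ) (memLp_dyadicDilate hψ j) l‖ ^ 2)
      (1 - ‖fourierL2 φ hφ l‖ ^ 2)) :
    ∃ (m : Lp ℂ ∞ (volume : Measure ℝ)) (mj : ℕ → Lp ℂ ∞ (volume : Measure ℝ)),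
      m =ᵐ[volume] (𝓕 (ofRealLp hφ.toLp) : Lp ℂ 2 (volume : Measure ℝ)) ∧
      (∀ j, mj j =ᵐ[volume]
        (𝓕 (ofRealLp (memLp_dyadicDilate hψ j).toLp) : Lp ℂ 2 (volume : Measure ℝ))) ∧
      ∀ᵐ x : ℝ, HasSum (fun j => (2 : ℝ) ^ j * ‖mj j x‖ ^ 2) (1 - ‖m x‖ ^ 2) := by
  have h2π : 2 * Real.pi ≠ 0 := by positivity
  have hsum : ∀ᵐ x : ℝ, HasSum (fun j : ℕ => (2 : ℝ) ^ j *
      ‖(𝓕 (ofRealLp (memLp_dyadicDilate hψ j).toLp) : Lp ℂ 2 (volume : Measure ℝ)) x‖ ^ 2)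
      (1 - ‖(𝓕 (ofRealLp hφ.toLp) : Lp ℂ 2 (volume : Measure ℝ)) x‖ ^ 2) := by
    filter_upwards [ae_comp_mul_left h2π hLP] with x hx
    simpa only [fourierL2, ofRealLp_toLp, mul_div_cancel_left₀ x h2π] using hx
  have hφ1 : ∀ᵐ x, ‖(𝓕 (ofRealLp hφ.toLp) : Lp ℂ 2 (volume : Measure ℝ)) x‖ ≤ 1 := by
    filter_upwards [hsum] with x hx
    have := hx.nonneg fun j => by positivity
    exact (sq_le_one_iff₀ (norm_nonneg _)).1 (by linarith)
  have hψ1 : ∀ j, ∀ᵐ x, ‖(𝓕 (ofRealLp (memLp_dyadicDilate hψ j).toLp) :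
      Lp ℂ 2 (volume : Measure ℝ)) x‖ ≤ 1 := by
    intro j
    filter_upwards [hsum] with x hx
    have h1 := le_hasSum hx j fun i _ => by positivity
    refine (sq_le_one_iff₀ (norm_nonneg _)).1 ?_
    have h2 : (1 : ℝ) ≤ 2 ^ j := one_le_pow₀ one_le_two
    have h3 := le_mul_of_one_le_left (sq_nonneg ‖(𝓕 (ofRealLp (memLp_dyadicDilate hψ j).toLp) :
      Lp ℂ 2 (volume : Measure ℝ)) x‖) h2
    have h4 := sq_nonneg ‖(𝓕 (ofRealLp hφ.toLp) : Lp ℂ 2 (volume : Measure ℝ)) x‖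
    linarith
  obtain ⟨m, hm⟩ := exists_Lp_top_of_norm_le_one hφ1
  choose mj hmj using fun j => exists_Lp_top_of_norm_le_one (hψ1 j)
  refine ⟨m, mj, hm, hmj, ?_⟩
  filter_upwards [hsum, hm, ae_all_iff.2 hmj] with x h1 h2 h3
  simpa only [h2, h3] using h1

end LittlewoodPaley

/-! ### Reconstruction of Brownian motion. -/

theorem proposition1 {Ω : Type*} [MeasurableSpace Ω] (P : Measure Ω) [IsProbabilityMeasure P]
    (B : ℝ → Ω → ℝ) (hB : IsTwoSidedBrownian B P)
    (φ ψ : ℝ → ℝ) (hφ : MemLp φ 2 (volume : Measure ℝ)) (hψ : MemLp ψ 2 (volume : Measure ℝ))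
    (hLP : ∀ᵐ l : ℝ, HasSum
      (fun j : ℕ => (2 : ℝ) ^ j * ‖fourierL2 (dyadicDilate j ψ) (memLp_dyadicDilate hψ j) l‖ ^ 2)
      (1 - ‖fourierL2 φ hφ l‖ ^ 2)) :
    (∃ ξ : ℝ → Ω → ℝ, IsWaveletTransform B P φ ξ) ∧
    (∀ j : ℕ, ∃ ξ : ℝ → Ω → ℝ, IsWaveletTransform B P (dyadicDilate j ψ) ξ) ∧
    ∀ (ξ : ℝ → Ω → ℝ) (ξj : ℕ → ℝ → Ω → ℝ),
      IsWaveletTransform B P φ ξ →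
      (∀ j : ℕ, IsWaveletTransform B P (dyadicDilate j ψ) (ξj j)) →
      ∀ t : ℝ, ∃ (Y : Ω → ℝ) (Z : ℕ → Ω → ℝ),
        IsConvIntegral P φ ξ t Y ∧
        (∀ j : ℕ, IsConvIntegral P (dyadicDilate j ψ) (ξj j) t (Z j)) ∧
        Tendsto (fun N : ℕ => eLpNorm
          (fun ω => Y ω + ∑ j ∈ Finset.range N, (2 : ℝ) ^ j * Z j ω - B t ω) 2 P)
          atTop (𝓝 0) := by
  obtain ⟨W, hWB, hW⟩ := hB.exists_wienerMap
  refine ⟨exists_isWaveletTransform hW hφ,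
    fun j => exists_isWaveletTransform hW (memLp_dyadicDilate hψ j), fun ξ ξj hξ hξj t => ?_⟩
  obtain ⟨m, mj, hm, hmj, hsum⟩ := exists_symbols hφ hψ hLP
  refine ⟨_, _, isConvIntegral_of_wienerMap hW hφ hξ hm t,
    fun j => isConvIntegral_of_wienerMap hW (memLp_dyadicDilate hψ j) (hξj j) (hmj j) t, ?_⟩
  -- The resolution of the identity at `1_t` is carried to L²(P); its limit becomes `W (stepLp t)`,
  -- which is `B t`.
  have h := ((W ∘L reLp).continuous.tendsto _).comp
    (tendsto_convOp_adjoint_sum hsum (ofRealLp (stepLp t)))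
  rw [Lp.tendsto_Lp_iff_tendsto_eLpNorm'] at h
  refine h.congr fun N => eLpNorm_congr_ae ?_
  simp only [Function.comp_apply, map_add, map_sum, map_smul, ContinuousLinearMap.comp_apply,
    reLp_ofRealLp]
  set y := W (reLp (convOp m (ContinuousLinearMap.adjoint (convOp m) (ofRealLp (stepLp t)))))
  set z : ℕ → Lp ℝ 2 P := fun j => W (reLp (convOp (mj j)
    (ContinuousLinearMap.adjoint (convOp (mj j)) (ofRealLp (stepLp t)))))
  filter_upwards [hWB t, Lp.coeFn_add y (∑ j ∈ Finset.range N, (2 : ℝ) ^ j • z j),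
    Lp.coeFn_finsetSum (Finset.range N) fun j => (2 : ℝ) ^ j • z j,
    ae_all_iff.2 fun j => Lp.coeFn_smul ((2 : ℝ) ^ j) (z j)] with ω h1 h2 h3 h4
  rw [Pi.sub_apply, h1, h2, Pi.add_apply, h3, Finset.sum_apply]
  simp only [h4, Pi.smul_apply, smul_eq_mul]
  rfl
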